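/- Theorem 5 (random geometric graph with bidirectional mobility). Place $n$ agents independently and uniformly at random on the unit torus (the unit square with opposite edges glued together, with its Euclidean distance). Before the algorithm starts, each agent flips an independent fair coin and is thereby permanently assigned to move either horizontally or vertically. Let each agent $i$ hold a real number $x_i(0)$, and let $r>0$ be a connectivity radius. At each time step $t=1,2,\dots$ the following happens, independently of the past: (1) every horizontal agent draws a new horizontal coordinate uniformly at random and keeps its initial vertical coordinate, every vertical agent draws a new vertical coordinate uniformly at random and keeps its initial horizontal coordinate, and all agents move independently of each other; (2) an agent $i$ is selected uniformly at random, and it selects an agent $j$ uniformly at random among the other agents that are at distance less than $r$ from $i$ (if there is none, nothing happens in this step); (3) agents $i$ and $j$ both replace their values by $\frac12(x_i(t-1)+x_j(t-1))$; the other values do not change. Write $x(t)\in\mathbb{R}^n$ for the vector of values at time $t$, $\bar x=\frac1n\sum_{i=1}^n x_i(0)$, and $\|\cdot\|$ for the Euclidean norm. For given initial locations and directions, and for $\epsilon>0$, the averaging time is $$T_{\mathrm{ave}}(n,\epsilon)=\sup_{x(0)\ne 0}\ \inf\Big\{t\in\{0,1,2,\dots\} : \mathbb{P}\Big(\frac{\|x(t)-\bar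 x\,\vec 1\|}{\|x(0)\|}\ge\epsilon\Big)\le\epsilon\Big\},$$ where the probability is over the motion and the selections. Then one can choose a connectivity radius $r=r(n)=\Theta\big(\sqrt{\log n/n}\big)$ such that, with high probability over the initial locations and directions, $T_{\mathrm{ave}}(n,\epsilon)=\Theta(n\log\epsilon^{-1})$. That is, there are such an $r$ and constants $c,C>0$, independent of $n$ and $\epsilon$, such that, with a probability that tends to $1$ as $n\to\infty$, the initial locations and directions satisfy, simultaneously for all $0<\epsilon<1$, $$c\,n\log\epsilon^{-1}\le T_{\mathrm{ave}}(n,\epsilon),\qquad\text{and}\qquad T_{\mathrm{ave}}(n,\epsilon)\le C\,n\log\epsilon^{-1}\ \text{ whenever } n\log\epsilon^{-1}\ge 1.$$ -/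

import Mathlib

open Filter MeasureTheory ProbabilityTheory Asymptotics
open scoped ENNReal Topology

noncomputable section

namespace MobileGossip

/-- The flat unit torus: the unit square with opposite edges glued together.
Its `volume` is the uniform probability distribution. -/
abbrev Torus : Type := UnitAddCircle × UnitAddCircle

instance : IsProbabilityMeasure (volume : Measure UnitAddCircle) :=
  ⟨by simp⟩

/-- The Euclidean (flat) distance on the unit torus. The norm of `UnitAddCircle` is the distance
to the nearest integer. (The metric that Mathlib puts on a product is the maximum metric.) -/
def torusDist (p q : Torus) : ℝ :=
  Real.sqrt (‖p.1 - q.1‖ ^ 2 + ‖p.2 - q.2‖ ^ 2)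

/-- The agents that agent `i` can contact when the agents are at the locations `l`: the agents
other than `i` at distance less than `r` from `i`. -/
def neighbors {n : ℕ} (r : ℝ) (l : Fin n → Torus) (i : Fin n) : Finset (Fin n) :=
  open Classical in Finset.univ.filter fun k => k ≠ i ∧ torusDist (l i) (l k) < r

/-- Agent `i` selects a neighbor uniformly. An agent without neighbors selects itself, in which
case the averaging step below changes nothing. -/
def partnerLaw {n : ℕ} (r : ℝ) (l : Fin n → Torus) (i : Fin n) : PMF (Fin n) :=
  open Classical in
  if h : (neighbors r l i).Nonempty then PMF.uniformOfFinset (neighbors r l i) h else PMF.pure i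

/-- Given the locations `l`, the law of the pair `(i, j)`: a uniformly selected agent `i` and the
neighbor `j` that it selects. -/
def contactLaw {n : ℕ} [NeZero n] (r : ℝ) (l : Fin n → Torus) : PMF (Fin n × Fin n) :=
  (PMF.uniformOfFintype (Fin n)).bind fun i => (partnerLaw r l i).map (Prod.mk i)

lemma measurable_torusDist : Measurable fun p : Torus × Torus => torusDist p.1 p.2 := by
  unfold torusDist
  have h : Continuous fun q : UnitAddCircle × UnitAddCircle => ‖q.1 - q.2‖ := by fun_prop
  have h1 : Measurable fun p : Torus × Torus => ‖p.1.1 - p.2.1‖ :=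
    h.measurable.comp (f := fun p : Torus × Torus => (p.1.1, p.2.1)) (by fun_prop)
  have h2 : Measurable fun p : Torus × Torus => ‖p.1.2 - p.2.2‖ :=
    h.measurable.comp (f := fun p : Torus × Torus => (p.1.2, p.2.2)) (by fun_prop)
  exact ((h1.pow_const 2).add (h2.pow_const 2)).sqrt

lemma measurable_contactLaw {n : ℕ} [NeZero n] (r : ℝ) :
    Measurable fun l : Fin n → Torus => (contactLaw r l).toMeasure := by
  classical
  let A : (Fin n → Torus) → (Fin n → Fin n → Prop) := fun l i k => torusDist (l i) (l k) < r
  have hA : Measurable A := by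
    refine measurable_pi_lambda _ fun i => measurable_pi_lambda _ fun k => ?_
    refine measurable_to_prop ?_
    have h : Measurable fun l : Fin n → Torus => torusDist (l i) (l k) :=
      measurable_torusDist.comp (f := fun l : Fin n → Torus => (l i, l k))
        ((measurable_pi_apply i).prodMk (measurable_pi_apply k))
    have : (fun l : Fin n → Torus => A l i k) ⁻¹' {True} =
        (fun l : Fin n → Torus => torusDist (l i) (l k)) ⁻¹' Set.Iio r := by
      ext l
      simp [A]
    rw [this]
    exact h measurableSet_Iio
  let N : (Fin n → Fin n → Prop) → Fin n → Finset (Fin n) :=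
    fun a i => Finset.univ.filter fun k => k ≠ i ∧ a i k
  let F : (Fin n → Fin n → Prop) → Measure (Fin n × Fin n) := fun a =>
    ((PMF.uniformOfFintype (Fin n)).bind fun i => PMF.map (Prod.mk i)
      (if h : (N a i).Nonempty then PMF.uniformOfFinset (N a i) h else PMF.pure i)).toMeasure
  have hF : Measurable F := measurable_of_finite F
  have hN : ∀ l i, neighbors r l i = N (A l) i := by
    intro l i
    ext k
    simp [neighbors, N, A]
  have h : (fun l : Fin n → Torus => (contactLaw r l).toMeasure) = F ∘ A := by
    funext l
    simp only [contactLaw, partnerLaw, F, Function.comp_apply, hN]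
  rw [h]
  exact hF.comp hA

/-- `contactLaw` as a Markov kernel from locations to pairs of agents. -/
def contactKernel {n : ℕ} [NeZero n] (r : ℝ) : Kernel (Fin n → Torus) (Fin n × Fin n) :=
  ⟨fun l => (contactLaw r l).toMeasure, measurable_contactLaw r⟩

instance {n : ℕ} [NeZero n] (r : ℝ) : IsMarkovKernel (contactKernel (n := n) r) :=
  ⟨fun l => by
    change IsProbabilityMeasure (contactLaw r l).toMeasure
    infer_instance⟩

/-- What happens in one time step: the new locations of the agents and the pair `(i, j)`. -/
abbrev StepOutcome (n : ℕ) : Type := (Fin n → Torus) × (Fin n × Fin n)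

/-- The law of one time step for the mobility pattern `μ`: the agents move independently, agent
`i` to a location with distribution `μ i`; then a contact is made at these locations. -/
def stepLaw {n : ℕ} [NeZero n] (μ : Fin n → Measure Torus) [∀ i, IsProbabilityMeasure (μ i)]
    (r : ℝ) : Measure (StepOutcome n) :=
  (Measure.pi μ) ⊗ₘ (contactKernel r)

instance {n : ℕ} [NeZero n] (μ : Fin n → Measure Torus) [∀ i, IsProbabilityMeasure (μ i)]
    (r : ℝ) : IsProbabilityMeasure (stepLaw μ r) := by
  unfold stepLaw
  infer_instance

/-- The law of a whole run: the time steps are independent and identically distributed.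
(`ω t` describes the step from time `t` to time `t + 1`.) -/
def runLaw {n : ℕ} [NeZero n] (μ : Fin n → Measure Torus) [∀ i, IsProbabilityMeasure (μ i)]
    (r : ℝ) : Measure (ℕ → StepOutcome n) :=
  Measure.infinitePi fun _ : ℕ => stepLaw μ r

/-- Agents `p.1` and `p.2` replace their estimates by the average of the two. -/
def gossipStep {n : ℕ} (p : Fin n × Fin n) (x : EuclideanSpace ℝ (Fin n)) :
    EuclideanSpace ℝ (Fin n) :=
  WithLp.toLp 2 fun k => if k = p.1 ∨ k = p.2 then (x p.1 + x p.2) / 2 else x k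

/-- The vector `x(t)` of estimates at time `t` in the run `ω`, started from `x₀`. -/
def estimates {n : ℕ} (x₀ : EuclideanSpace ℝ (Fin n)) (ω : ℕ → StepOutcome n) :
    ℕ → EuclideanSpace ℝ (Fin n)
  | 0 => x₀
  | t + 1 => gossipStep (ω t).2 (estimates x₀ ω t)

/-- The vector all of whose entries are the average of the entries of `x`. -/
def averageVector {n : ℕ} (x : EuclideanSpace ℝ (Fin n)) : EuclideanSpace ℝ (Fin n) :=
  WithLp.toLp 2 fun _ => (∑ i, x i) / n

/-- The `ε`-averaging time
`sup_{x(0) ≠ 0} inf {t : P(‖x(t) - x̄ 1‖ / ‖x(0)‖ ≥ ε) ≤ ε}`,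
which is `⊤` if for some `x(0)` there is no such `t`, or if the times are unbounded. -/
def averagingTime {n : ℕ} [NeZero n] (μ : Fin n → Measure Torus)
    [∀ i, IsProbabilityMeasure (μ i)] (r ε : ℝ) : ℕ∞ :=
  ⨆ (x₀ : EuclideanSpace ℝ (Fin n)) (_ : x₀ ≠ 0),
    ⨅ (t : ℕ) (_ : runLaw μ r {ω | ε ≤ ‖estimates x₀ ω t - averageVector x₀‖ / ‖x₀‖}
      ≤ ENNReal.ofReal ε), (t : ℕ∞)

/-- The initial locations and directions of motion (`true`: horizontal, `false`: vertical). -/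
abbrev Placement (n : ℕ) : Type := Fin n → Torus × Bool

/-- The agents are placed independently and uniformly on the torus, and each one
independently flips a fair coin for its direction of motion. -/
def placementLaw (n : ℕ) : Measure (Placement n) :=
  Measure.pi fun _ : Fin n =>
    (volume : Measure Torus).prod (PMF.uniformOfFintype Bool).toMeasure

/-- The bidirectional mobility pattern: a horizontal agent keeps its initial second coordinate
and draws a uniform first coordinate; a vertical agent does the opposite. -/
def bidirectionalMobility {n : ℕ} (η : Placement n) (i : Fin n) : Measure Torus :=
  if (η i).2 = true then (volume : Measure UnitAddCircle).prod (Measure.dirac (η i).1.2)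
  else (Measure.dirac (η i).1.1).prod (volume : Measure UnitAddCircle)

instance {n : ℕ} (η : Placement n) (i : Fin n) :
    IsProbabilityMeasure (bidirectionalMobility η i) := by
  unfold bidirectionalMobility
  split_ifs <;> infer_instance

end MobileGossip

end

/-!
The locations and the contact of one time step are independent of the past, and a contact `(i, j)`
lowers the squared distance of the estimates from their average by exactly `(xᵢ - xⱼ) ^ 2 / 2`. So
a Poincaré inequality with constant `γ` for the contact rates (`contactRate`) makes the expected
squared distance shrink by a factor `1 - γ` per step, and Markov's inequality turns this into an
averaging time of at most `⌈3 log(1/ε) / γ⌉` (`averagingTime_le`). The upper bound needs `γ` of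
order `1 / n`.

Here bidirectional mobility enters. The relative position of a horizontal and a vertical agent is
uniform on the torus, whatever their initial locations, so such a pair is within distance `r` with
probability of order `r ^ 2`. Given this, the expected number of neighbors is of order `n * r ^ 2`
as soon as no strip of width of order `r` is overcrowded. By convexity of `d ↦ 1 / d` every
horizontal-vertical pair has contact rate of order at least `1 / n ^ 2`
(`IsBalanced.le_contactRate`). If both classes have a positive fraction of the agents, comparison
with the complete bipartite graph gives the Poincaré inequality (`IsBalanced.gap`).

That placements are balanced with high probability follows from Chebyshev's inequality
(`placementLaw_not_isBalanced_le`): for a strip, which holds about `n * r` agents, the failure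
probability is of order `1 / (n * r)`, and the union over `1 / r` strips costs `1 / (n * r ^ 2)`.
This tends to zero for `r ^ 2 = log n / n`.

The lower bound holds for every placement and every radius (`le_averagingTime`): a step involves
two agents, so some agent remains untouched for `t` steps with probability at least
`(1 - 2 / n) ^ t`.
-/

namespace MobileGossip

/-! ### One averaging step -/

/-- With `φ = id` this is the invariance of the sum; with `φ` a square it gives the decrease of the
squared distance from the average. -/
lemma sum_gossipStep_comp {n : ℕ} (p : Fin n × Fin n) (x : EuclideanSpace ℝ (Fin n))
    (φ : ℝ → ℝ) :
    ∑ k, φ (gossipStep p x k) =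
      ∑ k, φ (x k) + (2 * φ ((x p.1 + x p.2) / 2) - φ (x p.1) - φ (x p.2)) := by
  obtain ⟨i, j⟩ := p
  by_cases hij : i = j
  · subst hij
    have h : ∀ k, gossipStep (i, i) x k = x k := by
      intro k
      simp only [gossipStep, or_self]
      split_ifs with hk
      · rw [hk]; ring
      · rfl
    simp only [h]
    have : (x i + x i) / 2 = x i := by ring
    rw [this]; ring
  · have h : ∑ k, (φ (gossipStep (i, j) x k) - φ (x k)) =
        (φ ((x i + x j) / 2) - φ (x i)) + (φ ((x i + x j) / 2) - φ (x j)) := by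
      rw [Finset.sum_eq_add i j hij]
      · simp [gossipStep]
      · rintro k - ⟨h1, h2⟩
        simp [gossipStep, h1, h2]
      · simp
      · simp
    rw [Finset.sum_sub_distrib] at h
    simp only
    linarith

lemma averageVector_gossipStep {n : ℕ} (p : Fin n × Fin n) (x : EuclideanSpace ℝ (Fin n)) :
    averageVector (gossipStep p x) = averageVector x := by
  have h := sum_gossipStep_comp p x id
  simp only [id] at h
  simp only [averageVector]
  congr 1
  funext _
  rw [h]
  ring

lemma averageVector_estimates {n : ℕ} (x₀ : EuclideanSpace ℝ (Fin n))
    (ω : ℕ → StepOutcome n) (t : ℕ) : averageVector (estimates x₀ ω t) = averageVector x₀ := by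
  induction t with
  | zero => rfl
  | succ t ih => rw [estimates, averageVector_gossipStep, ih]

lemma norm_sub_averageVector_sq {n : ℕ} (x : EuclideanSpace ℝ (Fin n)) :
    ‖x - averageVector x‖ ^ 2 = ∑ k, (x k - (∑ i, x i) / n) ^ 2 := by
  simp [EuclideanSpace.norm_sq_eq, averageVector]

/-- The mean minimizes the sum of squared deviations. -/
lemma sum_sub_mean_sq_le {ι : Type*} (s : Finset ι) (x : ι → ℝ) (c : ℝ) :
    ∑ k ∈ s, (x k - (∑ i ∈ s, x i) / s.card) ^ 2 ≤ ∑ k ∈ s, (x k - c) ^ 2 := by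
  rcases s.eq_empty_or_nonempty with rfl | hs
  · simp
  have hn : (s.card : ℝ) ≠ 0 := Nat.cast_ne_zero.2 hs.card_pos.ne'
  set a := (∑ i ∈ s, x i) / (s.card : ℝ) with ha
  have hsum : ∑ i ∈ s, x i = s.card * a := by rw [ha, mul_div_cancel₀ _ hn]
  have h : ∑ k ∈ s, (x k - c) ^ 2 = ∑ k ∈ s, (x k - a) ^ 2 + s.card * (a - c) ^ 2 := by
    have : ∀ k, (x k - c) ^ 2 = (x k - a) ^ 2 + (2 * (a - c) * x k + (c ^ 2 - a ^ 2)) := by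
      intro k; ring
    rw [Finset.sum_congr rfl fun k _ => this k]
    rw [Finset.sum_add_distrib, Finset.sum_add_distrib, ← Finset.mul_sum, hsum, Finset.sum_const,
      nsmul_eq_mul]
    ring
  rw [h]
  exact le_add_of_nonneg_right (mul_nonneg (Nat.cast_nonneg _) (sq_nonneg _))

lemma norm_sub_averageVector_sq_le {n : ℕ} (x : EuclideanSpace ℝ (Fin n)) (c : ℝ) :
    ‖x - averageVector x‖ ^ 2 ≤ ∑ k, (x k - c) ^ 2 := by
  have h := sum_sub_mean_sq_le Finset.univ x c
  rw [norm_sub_averageVector_sq]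
  simpa using h

lemma norm_sub_averageVector_le {n : ℕ} (x : EuclideanSpace ℝ (Fin n)) :
    ‖x - averageVector x‖ ≤ ‖x‖ := by
  have h := norm_sub_averageVector_sq_le x 0
  have h2 : ∑ k, (x k - 0) ^ 2 = ‖x‖ ^ 2 := by simp [EuclideanSpace.norm_sq_eq]
  rw [h2] at h
  exact le_of_sq_le_sq h (norm_nonneg _)

lemma norm_gossipStep_sub_averageVector_sq {n : ℕ} (p : Fin n × Fin n)
    (x : EuclideanSpace ℝ (Fin n)) :
    ‖gossipStep p x - averageVector (gossipStep p x)‖ ^ 2 =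
      ‖x - averageVector x‖ ^ 2 - (x p.1 - x p.2) ^ 2 / 2 := by
  have hs : ∑ i, gossipStep p x i = ∑ i, x i := by
    have h := sum_gossipStep_comp p x id
    simp only [id] at h
    rw [h]; ring
  rw [norm_sub_averageVector_sq, norm_sub_averageVector_sq, hs,
    sum_gossipStep_comp p x fun y => (y - (∑ i, x i) / n) ^ 2]
  ring

lemma measurable_gossipStep {n : ℕ} (p : Fin n × Fin n) : Measurable (gossipStep p) := by
  have h : Continuous (gossipStep p) := by
    refine (PiLp.continuous_toLp 2 _).comp (continuous_pi fun k => ?_)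
    split_ifs <;> fun_prop
  exact h.measurable

/-! ### The run of the algorithm -/

lemma measurable_estimates {n : ℕ} (x₀ : EuclideanSpace ℝ (Fin n)) (t : ℕ) :
    Measurable fun ω : ℕ → StepOutcome n => estimates x₀ ω t := by
  induction t with
  | zero => exact measurable_const
  | succ t ih =>
    have h : Measurable fun q : (Fin n × Fin n) × EuclideanSpace ℝ (Fin n) =>
        gossipStep q.1 q.2 :=
      measurable_from_prod_countable_right fun p => measurable_gossipStep p
    exact h.comp (f := fun ω : ℕ → StepOutcome n => ((ω t).2, estimates x₀ ω t))
      ((measurable_snd.comp (measurable_pi_apply t)).prodMk ih)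

lemma estimates_congr {n : ℕ} (x₀ : EuclideanSpace ℝ (Fin n)) {ω ω' : ℕ → StepOutcome n}
    (t : ℕ) (h : ∀ s < t, ω s = ω' s) : estimates x₀ ω t = estimates x₀ ω' t := by
  induction t with
  | zero => rfl
  | succ t ih => rw [estimates, estimates, ih fun s hs => h s (by omega), h t (by omega)]

/-- The estimates at time `t` depend on the steps before time `t` only, hence are independent of
the contact that follows. -/
lemma indepFun_estimates_contact {n : ℕ} [NeZero n] (μ : Fin n → Measure Torus)
    [∀ i, IsProbabilityMeasure (μ i)] (r : ℝ) (x₀ : EuclideanSpace ℝ (Fin n)) (t : ℕ) :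
    IndepFun (fun ω : ℕ → StepOutcome n => estimates x₀ ω t) (fun ω => (ω t).2)
      (runLaw μ r) := by
  have hi : iIndepFun (fun (s : ℕ) (ω : ℕ → StepOutcome n) => ω s) (runLaw μ r) :=
    iIndepFun_infinitePi (X := fun _ o => o) fun _ => measurable_id
  have h := hi.indepFun_finset (Finset.range t) {t} (by simp) fun s => measurable_pi_apply s
  let extend : ((s : Finset.range t) → StepOutcome n) → ℕ → StepOutcome n := fun y s =>
    if hs : s ∈ Finset.range t then y ⟨s, hs⟩ else (0, (0, 0))
  have hm : Measurable extend := by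
    refine measurable_pi_lambda _ fun s => ?_
    by_cases hs : s ∈ Finset.range t
    · simp only [extend, hs, dite_true]
      exact measurable_pi_apply _
    · simp only [extend, hs, dite_false]
      exact measurable_const
  have h2 := h.comp (φ := fun y => estimates x₀ (extend y) t)
    (ψ := fun y => (y ⟨t, by simp⟩).2) ((measurable_estimates x₀ t).comp hm)
    (measurable_snd.comp (measurable_pi_apply _))
  convert h2 using 1
  · funext ω
    refine estimates_congr x₀ t fun s hs => ?_
    simp [extend, hs]
  · rfl

/-- The probability that in one step agent `i` is selected and selects agent `j`. -/
noncomputable def contactRate {n : ℕ} [NeZero n] (μ : Fin n → Measure Torus)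
    [∀ i, IsProbabilityMeasure (μ i)] (r : ℝ) (p : Fin n × Fin n) : ℝ :=
  (stepLaw μ r).real {o | o.2 = p}

lemma measurableSet_contact {n : ℕ} (A : Set (Fin n × Fin n)) :
    MeasurableSet {o : StepOutcome n | o.2 ∈ A} :=
  measurable_snd (Set.toFinite A).measurableSet

lemma sum_contactRate {n : ℕ} [NeZero n] (μ : Fin n → Measure Torus)
    [∀ i, IsProbabilityMeasure (μ i)] (r : ℝ) : ∑ p, contactRate μ r p = 1 := by
  have h := sum_measureReal_preimage_singleton (μ := stepLaw μ r) Finset.univ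
    (f := fun o : StepOutcome n => o.2) fun y _ => measurableSet_contact {y}
  simpa [contactRate, Set.preimage] using h

/-- If the rates satisfy a Poincaré inequality with constant `γ`, then the expected squared
distance from the average is multiplied by at most `1 - γ` in each step. -/
lemma lintegral_norm_sq_estimates_le {n : ℕ} [NeZero n] (μ : Fin n → Measure Torus)
    [∀ i, IsProbabilityMeasure (μ i)] (r : ℝ) {γ : ℝ} (hγ : γ ≤ 1)
    (hgap : ∀ x : EuclideanSpace ℝ (Fin n),
      γ * ‖x - averageVector x‖ ^ 2 ≤ ∑ p, contactRate μ r p * ((x p.1 - x p.2) ^ 2 / 2))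
    (x₀ : EuclideanSpace ℝ (Fin n)) (t : ℕ) :
    ∫⁻ ω, ENNReal.ofReal (‖estimates x₀ ω t - averageVector x₀‖ ^ 2) ∂(runLaw μ r) ≤
      ENNReal.ofReal ((1 - γ) ^ t * ‖x₀‖ ^ 2) := by
  have : IsProbabilityMeasure (runLaw μ r) := by unfold runLaw; infer_instance
  let V : EuclideanSpace ℝ (Fin n) → ℝ := fun x => ‖x - averageVector x‖ ^ 2
  have hV : Measurable V := by
    have hc : Continuous (averageVector (n := n)) :=
      (PiLp.continuous_toLp 2 _).comp (continuous_pi fun k => by fun_prop)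
    exact ((continuous_id.sub hc).norm.pow 2).measurable
  have hVe : ∀ ω t, ‖estimates x₀ ω t - averageVector x₀‖ ^ 2 = V (estimates x₀ ω t) := by
    intro ω t
    simp only [V, averageVector_estimates]
  simp only [hVe]
  let χ : Fin n × Fin n → Fin n × Fin n → ℝ≥0∞ := fun p => Set.indicator {p} 1
  have hχ : ∀ p, Measurable (χ p) := fun p =>
    measurable_one.indicator (Set.toFinite _).measurableSet
  have hrate : ∀ p t, ∫⁻ ω, χ p (ω t).2 ∂(runLaw μ r) = ENNReal.ofReal (contactRate μ r p) := by
    intro p t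
    have hm : MeasurableSet {o : StepOutcome n | o.2 = p} := measurableSet_contact {p}
    rw [contactRate, ofReal_measureReal, ← lintegral_indicator_one hm,
      ← (measurePreserving_eval_infinitePi (fun _ : ℕ => stepLaw μ r) t).lintegral_comp
        (measurable_one.indicator hm)]
    rfl
  induction t with
  | zero =>
    simp only [estimates, lintegral_const, measure_univ, mul_one, pow_zero, one_mul, V]
    exact ENNReal.ofReal_le_ofReal
      (pow_le_pow_left₀ (norm_nonneg _) (norm_sub_averageVector_le x₀) 2)
  | succ t ih =>
    have hsplit : ∀ ω : ℕ → StepOutcome n, ENNReal.ofReal (V (estimates x₀ ω (t + 1))) =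
        ∑ p, ENNReal.ofReal (V (gossipStep p (estimates x₀ ω t))) * χ p (ω t).2 := by
      intro ω
      rw [Finset.sum_eq_single (ω t).2]
      · simp [χ, estimates]
      · intro p _ hp
        simp [χ, hp.symm]
      · simp
    have hVm : ∀ p, Measurable fun x => ENNReal.ofReal (V (gossipStep p x)) := fun p =>
      (hV.comp (measurable_gossipStep p)).ennreal_ofReal
    have hVω : ∀ p, Measurable fun ω : ℕ → StepOutcome n =>
        ENNReal.ofReal (V (gossipStep p (estimates x₀ ω t))) := fun p =>
      (hVm p).comp (measurable_estimates x₀ t)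
    have hχm : ∀ p, Measurable fun ω : ℕ → StepOutcome n => χ p (ω t).2 := fun p =>
      (hχ p).comp (measurable_snd.comp (measurable_pi_apply t))
    have hstep : ∀ x, ∑ p, ENNReal.ofReal (V (gossipStep p x)) *
        ENNReal.ofReal (contactRate μ r p) ≤ ENNReal.ofReal (1 - γ) * ENNReal.ofReal (V x) := by
      intro x
      have h0 : ∀ p, 0 ≤ contactRate μ r p := fun p => measureReal_nonneg
      rw [← ENNReal.ofReal_mul (by linarith)]
      simp_rw [← ENNReal.ofReal_mul' (h0 _)]
      rw [← ENNReal.ofReal_sum_of_nonneg fun p _ => mul_nonneg (sq_nonneg _) (h0 p)]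
      refine ENNReal.ofReal_le_ofReal ?_
      have : ∑ p, V (gossipStep p x) * contactRate μ r p =
          V x - ∑ p, contactRate μ r p * ((x p.1 - x p.2) ^ 2 / 2) := by
        simp only [V, norm_gossipStep_sub_averageVector_sq, sub_mul, Finset.sum_sub_distrib,
          ← Finset.mul_sum, sum_contactRate, mul_one]
        simp only [mul_comm]
      rw [this]
      have := hgap x
      simp only [V]
      linarith
    calc ∫⁻ ω, ENNReal.ofReal (V (estimates x₀ ω (t + 1))) ∂(runLaw μ r)
        = ∑ p, (∫⁻ ω, ENNReal.ofReal (V (gossipStep p (estimates x₀ ω t))) ∂(runLaw μ r)) *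
            ENNReal.ofReal (contactRate μ r p) := by
          simp only [hsplit]
          rw [lintegral_finsetSum _ fun p _ => (hVω p).fun_mul (hχm p)]
          refine Finset.sum_congr rfl fun p _ => ?_
          rw [← hrate p t]
          exact lintegral_mul_eq_lintegral_mul_lintegral_of_indepFun (hVω p) (hχm p)
            ((indepFun_estimates_contact μ r x₀ t).comp (hVm p) (hχ p))
      _ = ∫⁻ ω, ∑ p, ENNReal.ofReal (V (gossipStep p (estimates x₀ ω t))) *
            ENNReal.ofReal (contactRate μ r p) ∂(runLaw μ r) := by
          rw [lintegral_finsetSum _ fun p _ => (hVω p).mul_const _]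
          refine Finset.sum_congr rfl fun p _ => ?_
          exact (lintegral_mul_const _ (hVω p)).symm
      _ ≤ ∫⁻ ω, ENNReal.ofReal (1 - γ) * ENNReal.ofReal (V (estimates x₀ ω t)) ∂(runLaw μ r) :=
          lintegral_mono fun ω => hstep _
      _ = ENNReal.ofReal (1 - γ) * ∫⁻ ω, ENNReal.ofReal (V (estimates x₀ ω t)) ∂(runLaw μ r) :=
          lintegral_const_mul _ (hV.comp (measurable_estimates x₀ t)).ennreal_ofReal
      _ ≤ ENNReal.ofReal (1 - γ) * ENNReal.ofReal ((1 - γ) ^ t * ‖x₀‖ ^ 2) := by gcongr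
      _ = ENNReal.ofReal ((1 - γ) ^ (t + 1) * ‖x₀‖ ^ 2) := by
          rw [← ENNReal.ofReal_mul (by linarith)]
          congr 1
          ring

/-! ### Upper bound for the averaging time -/

/-- A Poincaré inequality with constant `γ` bounds the averaging time by `⌈3 log(1/ε) / γ⌉`, by
Markov's inequality for the squared distance from the average: two factors `ε` come from squaring
the threshold, the third one is the failure probability. -/
lemma averagingTime_le {n : ℕ} [NeZero n] (μ : Fin n → Measure Torus)
    [∀ i, IsProbabilityMeasure (μ i)] (r : ℝ) {γ : ℝ} (hγ0 : 0 < γ) (hγ : γ ≤ 1)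
    (hgap : ∀ x : EuclideanSpace ℝ (Fin n),
      γ * ‖x - averageVector x‖ ^ 2 ≤ ∑ p, contactRate μ r p * ((x p.1 - x p.2) ^ 2 / 2))
    {ε : ℝ} (hε : 0 < ε) :
    averagingTime μ r ε ≤ (⌈3 * Real.log ε⁻¹ / γ⌉₊ : ℕ) := by
  refine iSup₂_le fun x₀ hx₀ => iInf₂_le_of_le _ ?_ le_rfl
  set t := ⌈3 * Real.log ε⁻¹ / γ⌉₊ with ht
  have hx : 0 < ‖x₀‖ := norm_pos_iff.2 hx₀
  have hpow : (1 - γ) ^ t ≤ ε ^ 3 := by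
    have h1 : (1 - γ) ^ t ≤ Real.exp (-γ) ^ t :=
      pow_le_pow_left₀ (by linarith) (by linarith [Real.add_one_le_exp (-γ)]) t
    have h2 : 3 * Real.log ε⁻¹ / γ ≤ t := Nat.le_ceil _
    rw [div_le_iff₀ hγ0, Real.log_inv] at h2
    refine h1.trans ?_
    have h3 : ε ^ 3 = Real.exp (3 * Real.log ε) := by
      rw [mul_comm, Real.exp_mul, Real.exp_log hε]
      norm_cast
    rw [h3, ← Real.exp_nat_mul, Real.exp_le_exp]
    linarith
  have hsub : {ω | ε ≤ ‖estimates x₀ ω t - averageVector x₀‖ / ‖x₀‖} ⊆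
      {ω | ENNReal.ofReal ((ε * ‖x₀‖) ^ 2) ≤
        ENNReal.ofReal (‖estimates x₀ ω t - averageVector x₀‖ ^ 2)} := by
    intro ω hω
    simp only [Set.mem_ofPred_eq, le_div_iff₀ hx] at hω ⊢
    exact ENNReal.ofReal_le_ofReal (pow_le_pow_left₀ (by positivity) hω 2)
  have hm : Measurable fun ω : ℕ → StepOutcome n =>
      ENNReal.ofReal (‖estimates x₀ ω t - averageVector x₀‖ ^ 2) :=
    (((measurable_estimates x₀ t).sub_const _).norm.pow_const 2).ennreal_ofReal
  have hpos : 0 < (ε * ‖x₀‖) ^ 2 := by positivity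
  calc runLaw μ r {ω | ε ≤ ‖estimates x₀ ω t - averageVector x₀‖ / ‖x₀‖}
      ≤ (∫⁻ ω, ENNReal.ofReal (‖estimates x₀ ω t - averageVector x₀‖ ^ 2) ∂(runLaw μ r)) /
          ENNReal.ofReal ((ε * ‖x₀‖) ^ 2) :=
        (measure_mono hsub).trans (meas_ge_le_lintegral_div hm.aemeasurable
          (ENNReal.ofReal_pos.2 hpos).ne' ENNReal.ofReal_ne_top)
    _ ≤ ENNReal.ofReal ((1 - γ) ^ t * ‖x₀‖ ^ 2) / ENNReal.ofReal ((ε * ‖x₀‖) ^ 2) := by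
        gcongr
        exact lintegral_norm_sq_estimates_le μ r hγ hgap x₀ t
    _ = ENNReal.ofReal ((1 - γ) ^ t * ‖x₀‖ ^ 2 / (ε * ‖x₀‖) ^ 2) :=
        (ENNReal.ofReal_div_of_pos hpos).symm
    _ ≤ ENNReal.ofReal ε := by
        refine ENNReal.ofReal_le_ofReal ?_
        rw [div_le_iff₀ hpos]
        calc (1 - γ) ^ t * ‖x₀‖ ^ 2 ≤ ε ^ 3 * ‖x₀‖ ^ 2 := by gcongr
          _ = ε * (ε * ‖x₀‖) ^ 2 := by ring

/-! ### Lower bound for the averaging time -/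

/-- Two agents take part in a contact, so some agent takes part with probability at most
`2 / n`. -/
lemma exists_agent_rarely_in_contact {n : ℕ} [NeZero n] (μ : Fin n → Measure Torus)
    [∀ i, IsProbabilityMeasure (μ i)] (r : ℝ) :
    ∃ a : Fin n, (stepLaw μ r).real {o | a = o.2.1 ∨ a = o.2.2} ≤ 2 / n := by
  have h : ∀ f : Fin n × Fin n → Fin n,
      ∑ a, (stepLaw μ r).real {o | a = f o.2} = 1 := by
    intro f
    have h := sum_measureReal_preimage_singleton (μ := stepLaw μ r) Finset.univ
      (f := fun o : StepOutcome n => f o.2) fun y _ => measurableSet_contact (f ⁻¹' {y})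
    simpa [Set.preimage, eq_comm] using h
  have hs : ∑ a, (stepLaw μ r).real {o | a = o.2.1 ∨ a = o.2.2} ≤
      ∑ _a : Fin n, (2 : ℝ) / n := by
    calc _ ≤ ∑ a, ((stepLaw μ r).real {o | a = o.2.1} + (stepLaw μ r).real {o | a = o.2.2}) :=
          Finset.sum_le_sum fun a _ => measureReal_union_le _ _
      _ = 2 := by
          rw [Finset.sum_add_distrib, h Prod.fst, h Prod.snd]; norm_num
      _ = _ := by
          have : (n : ℝ) ≠ 0 := Nat.cast_ne_zero.2 (NeZero.ne n)
          simp
          field_simp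
  obtain ⟨a, -, ha⟩ := Finset.exists_le_of_sum_le Finset.univ_nonempty hs
  exact ⟨a, ha⟩

lemma estimates_apply_of_untouched {n : ℕ} (x₀ : EuclideanSpace ℝ (Fin n)) (a : Fin n)
    {ω : ℕ → StepOutcome n} {t : ℕ}
    (h : ∀ s < t, ¬(a = (ω s).2.1 ∨ a = (ω s).2.2)) : estimates x₀ ω t a = x₀ a := by
  induction t with
  | zero => rfl
  | succ t ih =>
    rw [estimates, ← ih fun s hs => h s (by omega)]
    simp only [gossipStep]
    rw [if_neg (h t (by omega))]

/-- The steps are independent, so an agent that is rarely in contact stays untouched for long. -/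
lemma pow_le_runLaw_untouched {n : ℕ} [NeZero n] (hn : 2 ≤ n) (μ : Fin n → Measure Torus)
    [∀ i, IsProbabilityMeasure (μ i)] (r : ℝ) :
    ∃ a : Fin n, ∀ t : ℕ, ENNReal.ofReal ((1 - 2 / n) ^ t) ≤
      runLaw μ r {ω | ∀ s < t, ¬(a = (ω s).2.1 ∨ a = (ω s).2.2)} := by
  obtain ⟨a, ha⟩ := exists_agent_rarely_in_contact μ r
  refine ⟨a, fun t => ?_⟩
  have hm : MeasurableSet {o : StepOutcome n | a = o.2.1 ∨ a = o.2.2} :=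
    measurableSet_contact {q | a = q.1 ∨ a = q.2}
  have hset : {ω : ℕ → StepOutcome n | ∀ s < t, ¬(a = (ω s).2.1 ∨ a = (ω s).2.2)} =
      (↑(Finset.range t) : Set ℕ).pi fun _ => {o | a = o.2.1 ∨ a = o.2.2}ᶜ := by
    ext ω
    simp [Set.mem_pi]
  have h1 : (1 : ℝ) - 2 / n ≤ (stepLaw μ r).real {o | a = o.2.1 ∨ a = o.2.2}ᶜ := by
    rw [probReal_compl_eq_one_sub hm]
    linarith
  have h0 : (0 : ℝ) ≤ 1 - 2 / n := by
    have : (2 : ℝ) ≤ n := by exact_mod_cast hn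
    rw [sub_nonneg]
    exact div_le_one_of_le₀ this (by positivity)
  rw [hset, runLaw, Measure.infinitePi_pi _ fun _ _ => hm.compl, Finset.prod_const,
    Finset.card_range, ENNReal.ofReal_pow h0]
  gcongr
  rw [← ofReal_measureReal]
  exact ENNReal.ofReal_le_ofReal h1

/-- For any mobility pattern the averaging time is at least `n log(1/ε) / 4`: an agent that is
rarely in contact keeps its initial value for too long. -/
lemma le_averagingTime {n : ℕ} [NeZero n] (hn : 4 ≤ n) (μ : Fin n → Measure Torus)
    [∀ i, IsProbabilityMeasure (μ i)] (r : ℝ) {ε : ℝ} (hε : 0 < ε) (hε1 : ε < 1) :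
    (⌈1 / 4 * (n * Real.log ε⁻¹)⌉₊ : ℕ∞) ≤ averagingTime μ r ε := by
  obtain ⟨a, ha⟩ := pow_le_runLaw_untouched (by omega) μ r
  have hn' : (4 : ℝ) ≤ n := by exact_mod_cast hn
  have hn0 : (0 : ℝ) < n := by linarith
  -- The initial values are the indicator of `a`, shifted to have mean zero so that the ratio in
  -- the averaging time starts at `1`.
  let e : EuclideanSpace ℝ (Fin n) := EuclideanSpace.single a 1
  have hes : ∑ i, e i = 1 := by simp [e]
  let x₀ : EuclideanSpace ℝ (Fin n) := e - averageVector e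
  have hxa : x₀ a = 1 - 1 / n := by
    have : x₀ a = e a - (∑ i, e i) / n := rfl
    rw [this, hes]
    simp [e]
  have havg : averageVector x₀ = 0 := by
    have : ∑ i, x₀ i = 0 := by
      have h : ∀ i, x₀ i = e i - (∑ i, e i) / n := fun i => rfl
      simp only [h, hes, Finset.sum_sub_distrib]
      simp
    ext i
    simp [averageVector, this]
  have hx1 : ‖x₀‖ ≤ 1 := by
    refine (norm_sub_averageVector_le e).trans ?_
    simp [e]
  have hxa0 : 0 < 1 - 1 / (n : ℝ) := by
    have : 1 / (n : ℝ) ≤ 1 / 4 := by gcongr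
    linarith
  have hx0 : x₀ ≠ 0 := by
    intro h
    rw [h] at hxa
    simp only [PiLp.zero_apply] at hxa
    linarith
  have hxpos : 0 < ‖x₀‖ := norm_pos_iff.2 hx0
  -- `exp (-4 / n) ≤ 1 - 2 / n` because `exp (4 / n) ≥ 1 + 4 / n`.
  have hexp : Real.exp (-(4 / n)) ≤ 1 - 2 / (n : ℝ) := by
    have hu : 1 / (n : ℝ) ≤ 1 / 4 := by gcongr
    have hu0 : 0 < 1 / (n : ℝ) := by positivity
    have e2 : 2 / (n : ℝ) = 2 * (1 / n) := by ring
    have e4 : 4 / (n : ℝ) = 4 * (1 / n) := by ring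
    rw [e2, e4, Real.exp_neg, inv_le_comm₀ (Real.exp_pos _) (by linarith)]
    refine le_trans ?_ (Real.add_one_le_exp _)
    rw [inv_le_iff_one_le_mul₀ (by linarith)]
    nlinarith
  refine le_iSup₂_of_le x₀ hx0 (le_iInf₂ fun t ht => ?_)
  rw [Nat.cast_le, Nat.ceil_le]
  by_contra! hlt
  -- Before that time, `ε` is below both the probability that `a` is untouched and the ratio.
  have hεt : ε < Real.exp (-(4 / n)) ^ t := by
    rw [← Real.exp_nat_mul, ← Real.log_lt_iff_lt_exp hε]
    rw [Real.log_inv] at hlt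
    have h : (t : ℝ) * (-(4 / n)) = -(4 * t) / n := by ring
    rw [h, lt_div_iff₀ hn0]
    linarith
  refine absurd ht (not_le.2 ?_)
  have hεp : ε < (1 - 2 / (n : ℝ)) ^ t :=
    hεt.trans_le (pow_le_pow_left₀ (Real.exp_pos _).le hexp t)
  refine lt_of_lt_of_le ?_ ((ha t).trans (measure_mono fun ω hω => ?_))
  · exact (ENNReal.ofReal_lt_ofReal_iff (hε.trans hεp)).2 hεp
  · simp only [Set.mem_ofPred_eq, havg, sub_zero]
    rcases Nat.eq_zero_or_pos t with rfl | htpos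
    · simp only [estimates]
      rw [div_self hxpos.ne']
      exact hε1.le
    · rw [le_div_iff₀ hxpos]
      have h1 : 1 - 1 / (n : ℝ) ≤ ‖estimates x₀ ω t‖ := by
        have h := PiLp.norm_apply_le (estimates x₀ ω t) a
        rw [estimates_apply_of_untouched x₀ a hω, hxa] at h
        exact (le_abs_self _).trans h
      have h2 : ε ≤ 1 - 2 / (n : ℝ) := by
        refine hεp.le.trans (pow_le_of_le_one ?_ ?_ htpos.ne')
        · exact (Real.exp_pos _).le.trans hexp
        · have : 0 ≤ 2 / (n : ℝ) := by positivity
          linarith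
      have h3 : 1 / (n : ℝ) ≤ 2 / n := by gcongr; norm_num
      calc ε * ‖x₀‖ ≤ ε * 1 := by gcongr
        _ ≤ ‖estimates x₀ ω t‖ := by linarith

/-! ### A Poincaré inequality for the complete bipartite graph -/

lemma card_mul_sub_mean_sq_le {ι : Type*} {s : Finset ι} (x : ι → ℝ) (y : ℝ) :
    s.card * (y - (∑ j ∈ s, x j) / s.card) ^ 2 ≤ ∑ j ∈ s, (y - x j) ^ 2 := by
  rcases s.eq_empty_or_nonempty with rfl | hs
  · simp
  have hn : (0 : ℝ) < s.card := Nat.cast_pos.2 hs.card_pos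
  have h := sq_sum_le_card_mul_sum_sq (s := s) (f := fun j => y - x j)
  have h2 : ∑ j ∈ s, (y - x j) = s.card * (y - (∑ j ∈ s, x j) / s.card) := by
    rw [Finset.sum_sub_distrib]
    simp
    field_simp
  rw [h2] at h
  refine le_of_mul_le_mul_left (le_trans (le_of_eq ?_) h) hn
  ring

/-- Each class is compared with the mean of the other one. -/
lemma bipartite_poincare {n : ℕ} (s : Finset (Fin n)) (hs : (n : ℝ) / 4 ≤ s.card)
    (hs' : (n : ℝ) / 4 ≤ sᶜ.card) (x : EuclideanSpace ℝ (Fin n)) :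
    n / 8 * ‖x - averageVector x‖ ^ 2 ≤ ∑ i ∈ s, ∑ j ∈ sᶜ, (x i - x j) ^ 2 := by
  set D := ∑ i ∈ s, ∑ j ∈ sᶜ, (x i - x j) ^ 2 with hD
  have hD' : D = ∑ j ∈ sᶜ, ∑ i ∈ s, (x j - x i) ^ 2 := by
    rw [hD, Finset.sum_comm]
    exact Finset.sum_congr rfl fun _ _ => Finset.sum_congr rfl fun _ _ => by ring
  set a := (∑ i ∈ s, x i) / s.card
  set b := (∑ j ∈ sᶜ, x j) / sᶜ.card
  have h1 : n / 4 * ∑ i ∈ s, (x i - b) ^ 2 ≤ D := by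
    rw [hD, Finset.mul_sum]
    refine Finset.sum_le_sum fun i _ => le_trans ?_ (card_mul_sub_mean_sq_le _ _)
    gcongr
  have h2 : n / 4 * ∑ j ∈ sᶜ, (x j - a) ^ 2 ≤ D := by
    rw [hD', Finset.mul_sum]
    refine Finset.sum_le_sum fun i _ => le_trans ?_ (card_mul_sub_mean_sq_le _ _)
    gcongr
  have h3 : ∑ j ∈ sᶜ, (x j - b) ^ 2 ≤ ∑ j ∈ sᶜ, (x j - a) ^ 2 := sum_sub_mean_sq_le _ _ _
  have h4 := norm_sub_averageVector_sq_le x b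
  rw [← Finset.sum_add_sum_compl s] at h4
  have hn : (0 : ℝ) ≤ n := by positivity
  nlinarith

/-! ### A lower bound for the contact rate -/

lemma pi_real_setPi {n : ℕ} (μ : Fin n → Measure Torus) [∀ i, IsProbabilityMeasure (μ i)]
    (s : Finset (Fin n)) {S : Fin n → Set Torus} (hS : ∀ i, MeasurableSet (S i)) :
    (Measure.pi μ).real {l | ∀ i ∈ s, l i ∈ S i} = ∏ i ∈ s, (μ i).real (S i) := by
  have h := Measure.infinitePi_pi μ (s := s) (t := S) fun i _ => hS i
  rw [Measure.infinitePi_eq_pi] at h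
  simp only [Measure.real, ← ENNReal.toReal_prod, ← h]
  rfl

lemma le_contactLaw {n : ℕ} [NeZero n] {r : ℝ} {l : Fin n → Torus} {i j : Fin n}
    (h : j ∈ neighbors r l i) :
    (n : ℝ)⁻¹ * ((neighbors r l i).card : ℝ)⁻¹ ≤ (contactLaw r l (i, j)).toReal := by
  have hN : (neighbors r l i).Nonempty := ⟨j, h⟩
  have h1 : (n : ℝ≥0∞)⁻¹ * ((neighbors r l i).card : ℝ≥0∞)⁻¹ ≤ contactLaw r l (i, j) := by
    rw [contactLaw, PMF.bind_apply]
    refine le_trans ?_ (ENNReal.le_tsum i)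
    rw [PMF.uniformOfFintype_apply, Fintype.card_fin, PMF.map_apply]
    gcongr
    refine le_trans ?_ (ENNReal.le_tsum j)
    simp only [if_true, partnerLaw, dif_pos hN]
    rw [PMF.uniformOfFinset_apply_of_mem hN h]
  have h2 := ENNReal.toReal_mono (PMF.apply_ne_top _ _) h1
  simpa using h2

/-- If `i` in `Sᵢ` and `j` in `Sⱼ` forces `i` and `j` to be within distance `r`, and all neighbors
of `i` to lie in `Q`, then the contact rate of `(i, j)` is at least the probability that `i` is
selected, times the probability of that event, over (a bound for) one plus the expected number of
agents in `Q`. -/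
lemma le_contactRate {n : ℕ} [NeZero n] (μ : Fin n → Measure Torus)
    [∀ i, IsProbabilityMeasure (μ i)] {r : ℝ} {i j : Fin n} (hij : i ≠ j)
    {Si Sj Q : Set Torus} (hSi : MeasurableSet Si) (hSj : MeasurableSet Sj)
    (hQ : MeasurableSet Q) (hnear : ∀ p ∈ Si, ∀ q ∈ Sj, torusDist p q < r)
    (hfar : ∀ p ∈ Si, ∀ q, torusDist p q < r → q ∈ Q) {m : ℝ}
    (hm : 1 + ∑ k, (μ k).real Q ≤ m) :
    (μ i).real Si * (μ j).real Sj / (n * m) ≤ contactRate μ r (i, j) := by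
  classical
  have hn : (0 : ℝ) < n := Nat.cast_pos.2 (NeZero.pos n)
  have hm0 : 0 < m := lt_of_lt_of_le (by positivity) hm
  let E : Finset (Fin n) := {i, j}ᶜ
  let A : Set (Fin n → Torus) := {l | l i ∈ Si ∧ l j ∈ Sj}
  let B : Fin n → Set (Fin n → Torus) := fun k => {l | (l i ∈ Si ∧ l j ∈ Sj) ∧ l k ∈ Q}
  have hA : MeasurableSet A := (measurable_pi_apply i hSi).inter (measurable_pi_apply j hSj)
  have hB : ∀ k, MeasurableSet (B k) := fun k => hA.inter (measurable_pi_apply k hQ)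
  let S : Fin n → Set Torus := fun k => if k = i then Si else if k = j then Sj else Q
  have hS : ∀ k, MeasurableSet (S k) := by
    intro k
    simp only [S]
    split_ifs <;> assumption
  have hSi' : S i = Si := by simp [S]
  have hSj' : S j = Sj := by simp [S, hij.symm]
  have hPA : (Measure.pi μ).real A = (μ i).real Si * (μ j).real Sj := by
    have h := pi_real_setPi μ {i, j} hS
    rw [Finset.prod_pair hij, hSi', hSj'] at h
    rw [← h]
    congr 1
    ext l
    simp [A, hSi', hSj']
  have hPB : ∀ k ∈ E, (Measure.pi μ).real (B k) =
      (μ i).real Si * (μ j).real Sj * (μ k).real Q := by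
    intro k hk
    simp only [E, Finset.mem_compl, Finset.mem_insert, Finset.mem_singleton, not_or] at hk
    have hSk : S k = Q := by simp [S, hk]
    have h := pi_real_setPi μ {k, i, j} hS
    rw [Finset.prod_insert (by simp [hk]), Finset.prod_pair hij, hSi', hSj', hSk, mul_comm] at h
    rw [← h]
    congr 1
    ext l
    simp only [B, Set.mem_ofPred_eq, Finset.mem_insert, Finset.mem_singleton, forall_eq_or_imp,
      forall_eq, hSi', hSj', hSk]
    tauto
  let f : (Fin n → Torus) → ℝ := fun l =>
    (n : ℝ)⁻¹ * ((2 / m - 1 / m ^ 2) * A.indicator 1 l - 1 / m ^ 2 * ∑ k ∈ E, (B k).indicator 1 l)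
  -- The number of neighbors is at most `d = 1 + #{k ∉ {i, j} | l k ∈ Q}`, and `1 / d` is above its
  -- tangent line at `m`, which is linear in `d`.
  have hf : ∀ l, f l ≤ (contactLaw r l (i, j)).toReal := by
    intro l
    by_cases hl : l ∈ A
    · have hj : j ∈ neighbors r l i := by
        simp only [neighbors, Finset.mem_filter, Finset.mem_univ, true_and]
        exact ⟨hij.symm, hnear _ hl.1 _ hl.2⟩
      refine le_trans ?_ (le_contactLaw hj)
      have hcard : 0 < ((neighbors r l i).card : ℝ) := Nat.cast_pos.2 (Finset.card_pos.2 ⟨j, hj⟩)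
      have hsub : neighbors r l i ⊆ insert j (E.filter fun k => l k ∈ Q) := by
        intro k hk
        simp only [neighbors, Finset.mem_filter, Finset.mem_univ, true_and] at hk
        have := hfar _ hl.1 _ hk.2
        by_cases hkj : k = j <;> simp [hkj, E, hk.1, this]
      have hd : ((neighbors r l i).card : ℝ) ≤
          1 + ∑ k ∈ E, (B k).indicator (1 : (Fin n → Torus) → ℝ) l := by
        have h1 : ((neighbors r l i).card : ℝ) ≤ (E.filter fun k => l k ∈ Q).card + 1 := by
          exact_mod_cast (Finset.card_le_card hsub).trans (Finset.card_insert_le _ _)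
        have h2 : ((E.filter fun k => l k ∈ Q).card : ℝ) =
            ∑ k ∈ E, (B k).indicator (1 : (Fin n → Torus) → ℝ) l := by
          rw [Finset.card_filter]
          push_cast
          refine Finset.sum_congr rfl fun k _ => ?_
          have : l ∈ B k ↔ l k ∈ Q := ⟨fun h => h.2, fun h => ⟨hl, h⟩⟩
          by_cases hk : l k ∈ Q <;> simp [Set.indicator, this, hk]
        linarith
      simp only [f, Set.indicator_of_mem hl, Pi.one_apply, mul_one]
      refine mul_le_mul_of_nonneg_left ?_ (by positivity)
      set d := ((neighbors r l i).card : ℝ)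
      have ht : 2 / m - d / m ^ 2 ≤ d⁻¹ := by
        rw [← sub_nonneg]
        have : d⁻¹ - (2 / m - d / m ^ 2) = (d - m) ^ 2 / (d * m ^ 2) := by
          field_simp
          ring
        rw [this]
        positivity
      have hd' : d / m ^ 2 ≤
          (1 + ∑ k ∈ E, (B k).indicator (1 : (Fin n → Torus) → ℝ) l) / m ^ 2 := by gcongr
      rw [add_div] at hd'
      have e : 1 / m ^ 2 * ∑ k ∈ E, (B k).indicator (1 : (Fin n → Torus) → ℝ) l =
        (∑ k ∈ E, (B k).indicator (1 : (Fin n → Torus) → ℝ) l) / m ^ 2 := by ring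
      rw [e]
      linarith
    · have hB0 : ∀ k, (B k).indicator (1 : (Fin n → Torus) → ℝ) l = 0 := fun k =>
        Set.indicator_of_notMem (fun h => hl h.1) _
      simp only [f, hB0, Set.indicator_of_notMem hl]
      simp
  have hAi : Integrable (A.indicator (1 : (Fin n → Torus) → ℝ)) (Measure.pi μ) :=
    (integrable_const (1 : ℝ)).indicator hA
  have hBi : ∀ k, Integrable ((B k).indicator (1 : (Fin n → Torus) → ℝ)) (Measure.pi μ) := fun k =>
    (integrable_const (1 : ℝ)).indicator (hB k)
  have hfi : Integrable f (Measure.pi μ) :=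
    ((hAi.const_mul _).sub ((integrable_finsetSum E fun k _ => hBi k).const_mul _)).const_mul _
  have hint : ∫ l, f l ∂(Measure.pi μ) = (n : ℝ)⁻¹ * ((2 / m - 1 / m ^ 2) *
      ((μ i).real Si * (μ j).real Sj) - 1 / m ^ 2 *
        ∑ k ∈ E, (μ i).real Si * (μ j).real Sj * (μ k).real Q) := by
    simp only [f]
    rw [integral_const_mul, integral_sub (hAi.const_mul _)
      ((integrable_finsetSum E fun k _ => hBi k).const_mul _), integral_const_mul,
      integral_const_mul, integral_finsetSum _ fun k _ => hBi k, integral_indicator_one hA, hPA]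
    simp only [integral_indicator_one (hB _)]
    rw [Finset.sum_congr rfl hPB]
  have hcoe : ∀ l, contactKernel r l {(i, j)} = contactLaw r l (i, j) := fun l =>
    PMF.toMeasure_apply_singleton _ _ (measurableSet_singleton _)
  have hmeas : Measurable fun l : Fin n → Torus => contactLaw r l (i, j) := by
    simpa only [hcoe] using
      Kernel.measurable_coe (contactKernel (n := n) r) (measurableSet_singleton (i, j))
  have hrate : contactRate μ r (i, j) = ∫ l, (contactLaw r l (i, j)).toReal ∂(Measure.pi μ) := by
    rw [integral_toReal hmeas.aemeasurable (ae_of_all _ fun l => PMF.apply_lt_top _ _),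
      contactRate, Measure.real, stepLaw,
      Measure.compProd_apply (measurableSet_contact {(i, j)} : MeasurableSet {o | o.2 = (i, j)})]
    congr 1
    exact lintegral_congr fun l => hcoe l
  have hci : Integrable (fun l => (contactLaw r l (i, j)).toReal) (Measure.pi μ) :=
    Integrable.of_bound hmeas.ennreal_toReal.aestronglyMeasurable 1 <| ae_of_all _ fun l => by
      rw [Real.norm_of_nonneg ENNReal.toReal_nonneg]
      exact ENNReal.toReal_le_of_le_ofReal zero_le_one (by simpa using PMF.coe_le_one _ _)
  rw [hrate]
  refine le_trans ?_ (integral_mono hfi hci hf)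
  rw [hint, ← Finset.mul_sum]
  have hE : 1 + ∑ k ∈ E, (μ k).real Q ≤ m := by
    refine le_trans ?_ hm
    gcongr
    exact Finset.subset_univ E
  set P := (μ i).real Si * (μ j).real Sj with hP
  have hP0 : 0 ≤ P := mul_nonneg measureReal_nonneg measureReal_nonneg
  have e : (n : ℝ)⁻¹ * ((2 / m - 1 / m ^ 2) * P - 1 / m ^ 2 * (P * ∑ k ∈ E, (μ k).real Q)) =
      P / (n * m) + P / (n * m ^ 2) * (m - (1 + ∑ k ∈ E, (μ k).real Q)) := by
    field_simp
    ring
  rw [e]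
  exact le_add_of_nonneg_right (mul_nonneg (by positivity) (by linarith))

/-! ### The spectral gap at a balanced placement -/

/-- A placement is balanced at radius `r` if each direction of motion has at least a quarter of
the agents, and every strip of half-width `2 * r`, in either direction, holds at most
`12 * n * r` agents (three times its expected number). -/
structure IsBalanced {n : ℕ} (r : ℝ) (η : Placement n) : Prop where
  horizontal : (n : ℝ) / 4 ≤ (Finset.univ.filter fun k => (η k).2 = true).card
  vertical : (n : ℝ) / 4 ≤ (Finset.univ.filter fun k => (η k).2 = true)ᶜ.card
  strip_fst (u : UnitAddCircle) :
    ∑ k, (Metric.closedBall u (2 * r)).indicator (1 : UnitAddCircle → ℝ) (η k).1.1 ≤ 12 * n * r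
  strip_snd (u : UnitAddCircle) :
    ∑ k, (Metric.closedBall u (2 * r)).indicator (1 : UnitAddCircle → ℝ) (η k).1.2 ≤ 12 * n * r

lemma volume_real_closedBall (u : UnitAddCircle) {ρ : ℝ} (hρ : 0 ≤ ρ) :
    (volume : Measure UnitAddCircle).real (Metric.closedBall u ρ) = min 1 (2 * ρ) := by
  rw [Measure.real, AddCircle.volume_closedBall, ENNReal.toReal_ofReal]
  positivity

lemma bidirectionalMobility_real_prod {n : ℕ} (η : Placement n) (k : Fin n)
    {S T : Set UnitAddCircle} (hS : MeasurableSet S) (hT : MeasurableSet T) :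
    (bidirectionalMobility η k).real (S ×ˢ T) =
      if (η k).2 = true then volume.real S * T.indicator 1 (η k).1.2
      else S.indicator 1 (η k).1.1 * volume.real T := by
  unfold bidirectionalMobility
  split_ifs
  · rw [measureReal_prod_prod, measureReal_def (Measure.dirac _), Measure.dirac_apply' _ hT]
    congr 1
    by_cases h : (η k).1.2 ∈ T <;> simp [h]
  · rw [measureReal_prod_prod, measureReal_def (Measure.dirac _), Measure.dirac_apply' _ hS]
    congr 1
    by_cases h : (η k).1.1 ∈ S <;> simp [h]

/-- At a balanced placement every horizontal-vertical pair has contact rate of order `1 / n ^ 2`: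
the relative position of the two agents is uniform on the torus, so they are near with probability
of order `r ^ 2`, while the expected number of competing neighbors is of order `n * r ^ 2`. -/
lemma IsBalanced.le_contactRate {n : ℕ} [NeZero n] {r : ℝ} {η : Placement n}
    (hη : IsBalanced r η) (hr0 : 0 < r) (hr1 : r ≤ 1) (hnr : 1 ≤ n * r ^ 2) {i j : Fin n}
    (hi : (η i).2 = true) (hj : (η j).2 ≠ true) :
    1 / (97 * n ^ 2) ≤ contactRate (bidirectionalMobility η) r (i, j) := by
  have hn : (0 : ℝ) < n := Nat.cast_pos.2 (NeZero.pos n)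
  set x := (η j).1.1 with hx
  set y := (η i).1.2 with hy
  have hball : ∀ (u : UnitAddCircle) (ρ : ℝ), MeasurableSet (Metric.closedBall u ρ) :=
    fun u ρ => Metric.isClosed_closedBall.measurableSet
  -- The paths of `i` and `j` cross at `(x, y)`. Both agents are in the box of half-width `r / 2`
  -- around the crossing with probability `r ^ 2`, and then all neighbors of `i` are in the box of
  -- half-width `2 * r`, which agent `k` visits only if its own path passes through it.
  have hSi : (bidirectionalMobility η i).real (Metric.closedBall x (r / 2) ×ˢ {y}) = r := by
    rw [bidirectionalMobility_real_prod η i (hball _ _) (measurableSet_singleton y), if_pos hi,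
      volume_real_closedBall _ (by positivity), ← hy, mul_div_cancel₀ _ two_ne_zero,
      min_eq_right hr1]
    simp
  have hSj : (bidirectionalMobility η j).real ({x} ×ˢ Metric.closedBall y (r / 2)) = r := by
    rw [bidirectionalMobility_real_prod η j (measurableSet_singleton x) (hball _ _), if_neg hj,
      volume_real_closedBall _ (by positivity), ← hx, mul_div_cancel₀ _ two_ne_zero,
      min_eq_right hr1]
    simp
  have hQ : ∀ k, (bidirectionalMobility η k).real
      (Metric.closedBall x (2 * r) ×ˢ Metric.closedBall y (2 * r)) ≤
        4 * r * ((Metric.closedBall x (2 * r)).indicator 1 (η k).1.1 +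
          (Metric.closedBall y (2 * r)).indicator 1 (η k).1.2) := by
    intro k
    have h4 : min 1 (2 * (2 * r)) ≤ 4 * r := (min_le_right _ _).trans (by linarith)
    have h1 : 0 ≤ (Metric.closedBall x (2 * r)).indicator (1 : UnitAddCircle → ℝ) (η k).1.1 :=
      Set.indicator_nonneg (fun _ _ => zero_le_one) _
    have h2 : 0 ≤ (Metric.closedBall y (2 * r)).indicator (1 : UnitAddCircle → ℝ) (η k).1.2 :=
      Set.indicator_nonneg (fun _ _ => zero_le_one) _
    rw [bidirectionalMobility_real_prod η k (hball _ _) (hball _ _),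
      volume_real_closedBall _ (by positivity), volume_real_closedBall _ (by positivity)]
    split_ifs <;> nlinarith
  have hsum : 1 + ∑ k, (bidirectionalMobility η k).real
      (Metric.closedBall x (2 * r) ×ˢ Metric.closedBall y (2 * r)) ≤ 97 * (n * r ^ 2) := by
    have h := Finset.sum_le_sum fun k (_ : k ∈ Finset.univ) => hQ k
    rw [← Finset.mul_sum, Finset.sum_add_distrib] at h
    have h1 := mul_le_mul_of_nonneg_left (add_le_add (hη.strip_fst x) (hη.strip_snd y))
      (by positivity : 0 ≤ 4 * r)
    nlinarith
  have hij : i ≠ j := by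
    rintro rfl
    exact hj hi
  have key := MobileGossip.le_contactRate (bidirectionalMobility η) hij (r := r)
    ((hball x (r / 2)).prod (measurableSet_singleton y))
    ((measurableSet_singleton x).prod (hball y (r / 2)))
    ((hball x (2 * r)).prod (hball y (2 * r))) ?_ ?_ hsum
  · rw [hSi, hSj] at key
    refine le_trans (le_of_eq ?_) key
    field_simp
  · rintro ⟨p1, p2⟩ ⟨hp1, hp2⟩ ⟨q1, q2⟩ ⟨hq1, hq2⟩
    simp only [Set.mem_singleton_iff, Metric.mem_closedBall, dist_eq_norm] at hp1 hp2 hq1 hq2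
    subst hp2 hq1
    rw [norm_sub_rev] at hq2
    rw [torusDist, Real.sqrt_lt' hr0]
    have h1 := pow_le_pow_left₀ (norm_nonneg _) hp1 2
    have h2 := pow_le_pow_left₀ (norm_nonneg _) hq2 2
    simp only at h1 h2 ⊢
    nlinarith
  · rintro ⟨p1, p2⟩ ⟨hp1, hp2⟩ ⟨q1, q2⟩ hpq
    simp only [Set.mem_singleton_iff, Metric.mem_closedBall] at hp1 hp2
    rw [torusDist, Real.sqrt_lt' hr0, ← dist_eq_norm, ← dist_eq_norm] at hpq
    have h1 : dist p1 q1 ≤ r :=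
      le_of_sq_le_sq (by nlinarith [sq_nonneg (dist p2 q2)]) hr0.le
    have h2 : dist p2 q2 ≤ r :=
      le_of_sq_le_sq (by nlinarith [sq_nonneg (dist p1 q1)]) hr0.le
    subst hp2
    constructor
    · simp only [Metric.mem_closedBall]
      have := dist_triangle_left q1 x p1
      linarith
    · simp only [Metric.mem_closedBall]
      rw [dist_comm]
      linarith

/-- The spectral gap of order `1 / n`. Pairs `(i, j)` with `i` horizontal and `j` vertical suffice;
the constant is `1552 = 97 * 8 * 2`. -/
lemma IsBalanced.gap {n : ℕ} [NeZero n] {r : ℝ} {η : Placement n} (hη : IsBalanced r η)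
    (hr0 : 0 < r) (hr1 : r ≤ 1) (hnr : 1 ≤ n * r ^ 2) (x : EuclideanSpace ℝ (Fin n)) :
    1 / (1552 * n) * ‖x - averageVector x‖ ^ 2 ≤
      ∑ p, contactRate (bidirectionalMobility η) r p * ((x p.1 - x p.2) ^ 2 / 2) := by
  have hn : (0 : ℝ) < n := Nat.cast_pos.2 (NeZero.pos n)
  set s : Finset (Fin n) := Finset.univ.filter fun k => (η k).2 = true with hs
  calc 1 / (1552 * n) * ‖x - averageVector x‖ ^ 2
      = 1 / (97 * n ^ 2) * ((n / 8 * ‖x - averageVector x‖ ^ 2) / 2) := by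
        field_simp
        ring
    _ ≤ 1 / (97 * n ^ 2) * ((∑ i ∈ s, ∑ j ∈ sᶜ, (x i - x j) ^ 2) / 2) := by
        gcongr
        exact bipartite_poincare s hη.horizontal hη.vertical x
    _ = ∑ p ∈ s ×ˢ sᶜ, 1 / (97 * n ^ 2) * ((x p.1 - x p.2) ^ 2 / 2) := by
        rw [← Finset.sum_product', Finset.sum_div, Finset.mul_sum]
    _ ≤ ∑ p ∈ s ×ˢ sᶜ,
          contactRate (bidirectionalMobility η) r p * ((x p.1 - x p.2) ^ 2 / 2) := by
        refine Finset.sum_le_sum fun p hp => ?_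
        simp only [hs, Finset.mem_product, Finset.mem_compl, Finset.mem_filter, Finset.mem_univ,
          true_and] at hp
        gcongr
        exact hη.le_contactRate hr0 hr1 hnr hp.1 hp.2
    _ ≤ _ := Finset.sum_le_sum_of_subset_of_nonneg (Finset.subset_univ _) fun p _ _ =>
        mul_nonneg measureReal_nonneg (by positivity)

/-! ### Most placements are balanced -/

/-- Chebyshev's inequality for the number of independent points that fall into a set. -/
lemma pi_count_deviation_le {α : Type*} [MeasurableSpace α] (ν : Measure α)
    [IsProbabilityMeasure ν] (n : ℕ) {S : Set α} (hS : MeasurableSet S) {c : ℝ} (hc : 0 < c) :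
    Measure.pi (fun _ : Fin n => ν)
      {η | c ≤ |∑ k, S.indicator (1 : α → ℝ) (η k) - n * ν.real S|} ≤
        ENNReal.ofReal (n * ν.real S / c ^ 2) := by
  set P := Measure.pi fun _ : Fin n => ν
  let X : Fin n → (Fin n → α) → ℝ := fun k η => S.indicator (1 : α → ℝ) (η k)
  have hχ : Measurable (S.indicator (1 : α → ℝ)) := measurable_one.indicator hS
  have hX : ∀ k, Measurable (X k) := fun k => hχ.comp (measurable_pi_apply k)
  have hL : ∀ k, MemLp (X k) 2 P := fun k =>
    MemLp.of_bound (hX k).aestronglyMeasurable 1 <| ae_of_all _ fun η => by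
      by_cases h : η k ∈ S <;> simp [X, h]
  have hmean : ∀ k, ∫ η, X k η ∂P = ν.real S := by
    intro k
    rw [← integral_indicator_one hS]
    have h := integral_map (μ := P) (measurable_pi_apply k).aemeasurable hχ.aestronglyMeasurable
    rw [(measurePreserving_eval (fun _ : Fin n => ν) k).map_eq] at h
    exact h.symm
  have hind : iIndepFun X P := iIndepFun_pi (X := fun _ => S.indicator (1 : α → ℝ))
    fun _ => hχ.aemeasurable
  have hvar : ∀ k, Var[X k; P] ≤ ν.real S := by
    intro k
    refine (variance_le_expectation_sq (hX k).aestronglyMeasurable).trans (le_of_eq ?_)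
    rw [← hmean k]
    refine integral_congr_ae (ae_of_all _ fun η => ?_)
    by_cases h : η k ∈ S <;> simp [X, h]
  have hmean' : ∫ η, (∑ k, X k) η ∂P = n * ν.real S := by
    simp only [Finset.sum_apply]
    rw [integral_finsetSum _ fun k _ => (hL k).integrable (by norm_num)]
    simp [hmean]
  have hvar' : Var[∑ k, X k; P] ≤ n * ν.real S := by
    rw [IndepFun.variance_sum (fun k _ => hL k) fun i _ j _ hij => hind.indepFun hij]
    refine (Finset.sum_le_sum fun k _ => hvar k).trans (le_of_eq (by simp))
  have h := meas_ge_le_variance_div_sq (memLp_finsetSum' Finset.univ fun k _ => hL k) hc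
  rw [hmean'] at h
  simp only [Finset.sum_apply] at h
  refine h.trans (ENNReal.ofReal_le_ofReal ?_)
  gcongr

/-- The points `a / m`, `a < m`, form a `1 / m`-net of the circle. -/
lemma exists_grid_dist_le (u : UnitAddCircle) {m : ℕ} (hm : 0 < m) :
    ∃ a ∈ Finset.range m, dist u ((a / m : ℝ) : UnitAddCircle) ≤ 1 / m := by
  obtain ⟨y, hy, rfl⟩ : ∃ y : ℝ, y ∈ Set.Ico (0 : ℝ) 1 ∧ (y : UnitAddCircle) = u := by
    exact ⟨AddCircle.equivIco 1 0 u, by simpa using (AddCircle.equivIco (1 : ℝ) 0 u).2,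
      AddCircle.coe_equivIco⟩
  have hm' : (0 : ℝ) < m := Nat.cast_pos.2 hm
  have h0 : 0 ≤ y * m := mul_nonneg hy.1 hm'.le
  refine ⟨⌊y * m⌋₊, ?_, ?_⟩
  · rw [Finset.mem_range, Nat.floor_lt h0]
    nlinarith [hy.2]
  · have h1 := Nat.floor_le h0
    have h2 := Nat.lt_floor_add_one (y * m)
    rw [dist_eq_norm, ← AddCircle.coe_sub, UnitAddCircle.norm_eq]
    refine (round_le _ 0).trans ?_
    rw [Int.cast_zero, sub_zero]
    have e : y - (⌊y * m⌋₊ : ℝ) / m = (y * m - ⌊y * m⌋₊) / m := by field_simp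
    rw [e, abs_of_nonneg (div_nonneg (by linarith) hm'.le)]
    gcongr
    linarith

/-- With high probability no strip of half-width `2 * r` is overcrowded. Each strip lies in one of
half-width `3 * r` around one of `⌈1 / r⌉` grid points. -/
lemma measure_exists_crowded_strip_le {n : ℕ} [NeZero n] {α : Type*} [MeasurableSpace α]
    {ν : Measure α} [IsProbabilityMeasure ν] {g : α → UnitAddCircle}
    (hg : MeasurePreserving g ν volume) {r : ℝ} (hr0 : 0 < r) (hr1 : r ≤ 1) :
    Measure.pi (fun _ : Fin n => ν) {η | ∃ u : UnitAddCircle, 12 * n * r <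
      ∑ k, (Metric.closedBall u (2 * r)).indicator (1 : UnitAddCircle → ℝ) (g (η k))} ≤
        ENNReal.ofReal (1 / (3 * (n * r ^ 2))) := by
  have hn : (0 : ℝ) < n := Nat.cast_pos.2 (NeZero.pos n)
  set m := ⌈1 / r⌉₊ with hm
  have hm0 : 0 < m := Nat.ceil_pos.2 (by positivity)
  have hm0' : (0 : ℝ) < m := Nat.cast_pos.2 hm0
  have hmr : 1 / (m : ℝ) ≤ r := by
    rw [div_le_comm₀ hm0' hr0]
    exact Nat.le_ceil _
  have hm2 : (m : ℝ) ≤ 2 / r := by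
    have h1 : (m : ℝ) < 1 / r + 1 := Nat.ceil_lt_add_one (by positivity)
    have h2 : 1 ≤ 1 / r := by rwa [le_div_iff₀ hr0, one_mul]
    have h3 : 2 / r = 1 / r + 1 / r := by ring
    linarith
  let S : ℕ → Set α := fun a => g ⁻¹' Metric.closedBall ((a / m : ℝ) : UnitAddCircle) (3 * r)
  have hball : ∀ a : ℕ, MeasurableSet (Metric.closedBall ((a / m : ℝ) : UnitAddCircle) (3 * r)) :=
    fun a => Metric.isClosed_closedBall.measurableSet
  have hS : ∀ a, MeasurableSet (S a) := fun a => hg.measurable (hball a)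
  have hνS : ∀ a, ν.real (S a) ≤ 6 * r := by
    intro a
    have h : ν.real (S a) = min 1 (2 * (3 * r)) := by
      rw [← volume_real_closedBall _ (by positivity), Measure.real, Measure.real,
        hg.measure_preimage (hball a).nullMeasurableSet]
    rw [h]
    exact (min_le_right _ _).trans (by linarith)
  have hsub : {η : Fin n → α | ∃ u : UnitAddCircle, 12 * n * r <
      ∑ k, (Metric.closedBall u (2 * r)).indicator (1 : UnitAddCircle → ℝ) (g (η k))} ⊆
      ⋃ a ∈ Finset.range m, {η |
        6 * n * r ≤ |∑ k, (S a).indicator (1 : α → ℝ) (η k) - n * ν.real (S a)|} := by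
    rintro η ⟨u, hu⟩
    obtain ⟨a, ha, hua⟩ := exists_grid_dist_le u hm0
    refine Set.mem_biUnion ha ?_
    have h1 : ∑ k, (Metric.closedBall u (2 * r)).indicator (1 : UnitAddCircle → ℝ) (g (η k)) ≤
        ∑ k, (S a).indicator (1 : α → ℝ) (η k) := by
      refine Finset.sum_le_sum fun k _ => ?_
      by_cases h : g (η k) ∈ Metric.closedBall u (2 * r)
      · have h' : η k ∈ S a := by
          simp only [S, Set.mem_preimage, Metric.mem_closedBall] at h ⊢
          linarith [dist_triangle (g (η k)) u ((a / m : ℝ) : UnitAddCircle)]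
        simp [h, h']
      · rw [Set.indicator_of_notMem h]
        exact Set.indicator_nonneg (fun _ _ => zero_le_one) _
    have h2 := mul_le_mul_of_nonneg_left (hνS a) hn.le
    rw [Set.mem_ofPred_eq]
    refine le_trans ?_ (le_abs_self _)
    nlinarith
  calc _ ≤ ∑ a ∈ Finset.range m, Measure.pi (fun _ : Fin n => ν) {η |
        6 * n * r ≤ |∑ k, (S a).indicator (1 : α → ℝ) (η k) - n * ν.real (S a)|} :=
        (measure_mono hsub).trans (measure_biUnion_finset_le _ _)
    _ ≤ ∑ a ∈ Finset.range m, ENNReal.ofReal (1 / (6 * n * r)) := by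
        refine Finset.sum_le_sum fun a _ =>
          (pi_count_deviation_le ν n (hS a) (by positivity)).trans (ENNReal.ofReal_le_ofReal ?_)
        calc n * ν.real (S a) / (6 * n * r) ^ 2 ≤ n * (6 * r) / (6 * n * r) ^ 2 := by
              gcongr
              exact hνS a
          _ = 1 / (6 * n * r) := by field_simp
    _ = ENNReal.ofReal (m * (1 / (6 * n * r))) := by
        rw [Finset.sum_const, Finset.card_range, nsmul_eq_mul, ENNReal.ofReal_mul hm0'.le,
          ENNReal.ofReal_natCast]
    _ ≤ ENNReal.ofReal (1 / (3 * (n * r ^ 2))) := by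
        refine ENNReal.ofReal_le_ofReal ?_
        calc m * (1 / (6 * n * r)) ≤ 2 / r * (1 / (6 * n * r)) := by gcongr
          _ = 1 / (3 * (n * r ^ 2)) := by field_simp; norm_num

lemma placementLaw_not_isBalanced_le {n : ℕ} [NeZero n] {r : ℝ} (hr0 : 0 < r) (hr1 : r ≤ 1) :
    placementLaw n {η | ¬IsBalanced r η} ≤
      ENNReal.ofReal (8 / n + 1 / (3 * (n * r ^ 2)) + 1 / (3 * (n * r ^ 2))) := by
  have hn : (0 : ℝ) < n := Nat.cast_pos.2 (NeZero.pos n)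
  let ν : Measure (Torus × Bool) :=
    (volume : Measure Torus).prod (PMF.uniformOfFintype Bool).toMeasure
  have hfst : MeasurePreserving (fun p : Torus × Bool => p.1.1) ν volume :=
    measurePreserving_fst.comp measurePreserving_fst
  have hsnd : MeasurePreserving (fun p : Torus × Bool => p.1.2) ν volume :=
    measurePreserving_snd.comp measurePreserving_fst
  let H : Set (Torus × Bool) := {p | p.2 = true}
  have hH : MeasurableSet H := measurable_snd (measurableSet_singleton true)
  have hνH : ν.real H = 1 / 2 := by
    have h : ν H = (PMF.uniformOfFintype Bool).toMeasure {true} :=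
      measurePreserving_snd.measure_preimage (measurableSet_singleton true).nullMeasurableSet
    rw [Measure.real, h, PMF.toMeasure_apply_singleton _ _ (measurableSet_singleton true)]
    simp
  -- A number of horizontal agents within `n / 4` of its mean `n / 2` leaves at least `n / 4` agents
  -- for each direction.
  have hcoin := pi_count_deviation_le ν n hH (c := n / 4) (by positivity)
  have hcoin' : (n : ℝ) * ν.real H / (n / 4) ^ 2 = 8 / n := by
    rw [hνH]
    field_simp
    norm_num
  rw [hcoin'] at hcoin
  rw [ENNReal.ofReal_add (by positivity) (by positivity),
    ENNReal.ofReal_add (by positivity) (by positivity)]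
  refine le_trans (measure_mono fun η hη => ?_) ((measure_union_le _ _).trans
    (add_le_add ((measure_union_le _ _).trans (add_le_add hcoin
      (measure_exists_crowded_strip_le hfst hr0 hr1)))
      (measure_exists_crowded_strip_le hsnd hr0 hr1)))
  by_contra hcon
  simp only [Set.mem_union, Set.mem_ofPred_eq, not_or, not_exists, not_lt, not_le, hνH] at hcon
  obtain ⟨⟨hc, h1⟩, h2⟩ := hcon
  have hcard : ∑ k, H.indicator (1 : Torus × Bool → ℝ) (η k) =
      (Finset.univ.filter fun k => (η k).2 = true).card := by
    rw [Finset.card_filter]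
    push_cast
    refine Finset.sum_congr rfl fun k _ => ?_
    by_cases h : (η k).2 = true <;> simp [H, h]
  rw [hcard, abs_lt] at hc
  refine hη ⟨by linarith, ?_, h1, h2⟩
  rw [Finset.card_compl, Nat.cast_sub (Finset.card_le_univ _), Fintype.card_fin]
  linarith

end MobileGossip

theorem theorem5 :
    ∃ r : ℕ → ℝ,
      (∀ n, 0 ≤ r n) ∧
      r =Θ[atTop] (fun n : ℕ => Real.sqrt (Real.log n / n)) ∧
      ∃ c C : ℝ, 0 < c ∧ 0 < C ∧
        -- the probability of the placements at which a bound fails tends to zero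
        ∀ δ : ℝ, 0 < δ → ∃ N : ℕ, ∀ (n : ℕ) [NeZero n], N ≤ n →
          MobileGossip.placementLaw n {η | ¬ ∀ ε : ℝ, 0 < ε → ε < 1 →
            ENNReal.ofReal (c * (n * Real.log ε⁻¹)) ≤
              (MobileGossip.averagingTime (MobileGossip.bidirectionalMobility η) (r n) ε : ℝ≥0∞) ∧
            (1 ≤ n * Real.log ε⁻¹ →
              (MobileGossip.averagingTime (MobileGossip.bidirectionalMobility η) (r n) ε : ℝ≥0∞) ≤
                ENNReal.ofReal (C * (n * Real.log ε⁻¹)))}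
            ≤ ENNReal.ofReal δ := by
  refine ⟨fun n => Real.sqrt (Real.log n / n), fun n => Real.sqrt_nonneg _,
    isTheta_refl _ _, 1 / 4, 4657, by norm_num, by norm_num, fun δ hδ => ?_⟩
  have hlim : Tendsto (fun n : ℕ => 8 / (n : ℝ) + 1 / (3 * Real.log n) + 1 / (3 * Real.log n))
      atTop (𝓝 0) := by
    have h1 : Tendsto (fun n : ℕ => 8 / (n : ℝ)) atTop (𝓝 0) :=
      tendsto_const_div_atTop_nhds_zero_nat 8
    have h2 : Tendsto (fun n : ℕ => 1 / (3 * Real.log n)) atTop (𝓝 0) :=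
      tendsto_const_nhds.div_atTop ((Real.tendsto_log_atTop.comp
        tendsto_natCast_atTop_atTop).const_mul_atTop three_pos)
    simpa using (h1.add h2).add h2
  obtain ⟨N, hN⟩ := eventually_atTop.1 (hlim.eventually_lt_const hδ)
  refine ⟨max N 4, fun n _ hn => ?_⟩
  have hn4 : 4 ≤ n := (le_max_right _ _).trans hn
  have hn4' : (4 : ℝ) ≤ n := by exact_mod_cast hn4
  have hn0 : (0 : ℝ) < n := by linarith
  have hlog : 1 ≤ Real.log n := by
    rw [Real.le_log_iff_exp_le hn0]
    linarith [Real.exp_one_lt_d9]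
  beta_reduce
  set r := Real.sqrt (Real.log n / n) with hr
  have hr0 : 0 < r := Real.sqrt_pos.2 (by positivity)
  have hr1 : r ≤ 1 := by
    rw [hr, Real.sqrt_le_one]
    exact div_le_one_of_le₀ (Real.log_le_self hn0.le) hn0.le
  have hnr : n * r ^ 2 = Real.log n := by
    rw [hr, Real.sq_sqrt (by positivity)]
    field_simp
  have hprob := MobileGossip.placementLaw_not_isBalanced_le (n := n) hr0 hr1
  rw [hnr] at hprob
  refine le_trans
    (measure_mono (t := {η | ¬MobileGossip.IsBalanced r η}) fun η hη hbal => hη ?_)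
    (hprob.trans (ENNReal.ofReal_le_ofReal (hN n ((le_max_left _ _).trans hn)).le))
  intro ε hε hε1
  constructor
  · have h := MobileGossip.le_averagingTime hn4 (MobileGossip.bidirectionalMobility η) r hε hε1
    calc ENNReal.ofReal (1 / 4 * (n * Real.log ε⁻¹))
        ≤ ENNReal.ofReal (⌈1 / 4 * (n * Real.log ε⁻¹)⌉₊ : ℝ) :=
          ENNReal.ofReal_le_ofReal (Nat.le_ceil _)
      _ ≤ _ := by
          rw [ENNReal.ofReal_natCast]
          exact_mod_cast ENat.toENNReal_le.2 h
  · intro h1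
    have hγ : 1 / (1552 * (n : ℝ)) ≤ 1 := div_le_one_of_le₀ (by linarith) (by positivity)
    have h := MobileGossip.averagingTime_le (MobileGossip.bidirectionalMobility η) r
      (by positivity) hγ (MobileGossip.IsBalanced.gap hbal hr0 hr1 (by rw [hnr]; exact hlog)) hε
    refine (ENat.toENNReal_le.2 h).trans ?_
    rw [ENat.toENNReal_coe, ← ENNReal.ofReal_natCast]
    refine ENNReal.ofReal_le_ofReal ?_
    have e : 3 * Real.log ε⁻¹ / (1 / (1552 * n)) = 4656 * (n * Real.log ε⁻¹) := by
      field_simp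
      ring
    rw [e]
    have := Nat.ceil_lt_add_one (show 0 ≤ 4656 * (n * Real.log ε⁻¹) by linarith)
    linarith
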